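/- **Setting.** Let $V=\{Z,A,M,Y\}$ be four random variables (anchor, treatment, mediator, outcome) whose joint law has an almost everywhere positive density $p(Z,A,M,Y)$ with respect to a product of $\sigma$-finite measures (sums for discrete variables; all identities between densities are meant almost everywhere). An *ADMG* $\mathcal G$ on $V$ has directed edges $\to$ without directed cycles and bidirected edges $\leftrightarrow$. In a *CADMG* some vertices $W$ are fixed and no edge has an arrowhead at a fixed vertex; its *districts* are the bidirected-connected components of its random vertices. A random vertex $v$ is *fixable* if no other random vertex is both a descendant of $v$ and joined to $v$ by a bidirected path; *fixing* $v$ removes all edges with an arrowhead into $v$ and divides the current kernel $q$ by $q(v\mid \mathrm{mb}(v),W)$, where $\mathrm{mb}(v)$ consists of the district of $v$ and the parents of that district, without $v$. A set $S$ is fixable if its elements can be fixed one after the other in some order (a valid fixing sequence); for any set $S$, $\phi_S(\mathcal G)$ is $\mathcal G$ with all edges with an arrowhead into $S$ removed and $S$ fixed. A set $D$ is *intrinsic* if $V\setminus D$ is fixable and $D$ is the only district of $\phi_{V\setminus D}(\mathcal G)$. The density $p$ *nested-Markov factorizes* with respect to $\mathcal G$ if there are kernels $q_D(D\mid \mathrm{pa}_{\mathcal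 G}(D))$, one for each intrinsic $D$, such that for every valid fixing sequence $\sigma$ of every fixable set $S$ the kernel obtained from $p$ by fixing along $\sigma$ equals $\prod_{D} q_D(D\mid \mathrm{pa}_{\mathcal G}(D))$, the product over the districts $D$ of $\phi_S(\mathcal G)$. An intervention on $S$ is *identified* in $\mathcal G$ if every district of $\phi_S(\mathcal G)$ is intrinsic in $\mathcal G$. Two vertices are *m-separated* given $C$ if every path between them has a collider without a descendant in $C$ (a vertex being its own descendant) or a non-collider that is in $C$ or fixed. **Assumptions.** Let $p$ nested-Markov factorize with respect to an ADMG $\mathcal G$ such that - (A1) $M$ is a mediator between $A$ and $Y$: $A\to M\to Y$ in $\mathcal G$; - (A2) there is no directed path from $A$ to $Z$ in $\mathcal G$, and in $p$ neither $Z\perp A$ nor $Z\perp Y\mid A,M$ holds; - (A3) (Verma faithfulness) each conditional independence $X\perp X'\mid C$ of two variables in $p$ implies that $X,X'$ are m-separated given $C$ in $\mathcal G$; and whenever $X\perp X'\mid C$ holds, for (almost) every value of $S$, in a kernel $p(V)/\prod_{s\in S}p(s\mid \text{predecessors of } s)$ (predecessors in some topological order of $\mathcal G$; $X,X'\notin S\cup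 C$, $C\cap S=\emptyset$), although $X$ and $X'$ are not conditionally independent in $p$ given any set of other variables, the intervention on $S$ is identified in $\mathcal G$ and $X,X'$ are m-separated given $C$ in $\phi_S(\mathcal G)$. **Claim.** Suppose that $p$ satisfies both the Verma constraint $Z\perp Y$ in the kernel $p(Z,A,M,Y)/p(M\mid A,Z)$ over $(Z,A,Y)$, for (almost) every value of $M$, and the ordinary independence $Z\perp M\mid A$. Then the ADMG $\mathcal G$, with respect to which $p$ nested-Markov factorizes, satisfies the front-door conditions - (F1) there is no edge $A\to Y$, - (F2) there are no edges $A\leftrightarrow M$ and $M\leftrightarrow Y$, and the instrumental-variable conditions - (I1) $Z\to A$ or $Z\leftrightarrow A$ (or both) is in $\mathcal G$, - (I2) $Z$ and $Y$ are m-separated (given $\emptyset$) in the graph obtained from $\mathcal G$ by deleting $A$ and all edges involving $A$. In particular $p$ nested-Markov factorizes with respect to an ADMG satisfying (F1), (F2), (I1), (I2). -/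

import Mathlib

open MeasureTheory
open scoped ENNReal

/-! ### Conditional acyclic directed mixed graphs -/

/-- A conditional acyclic directed mixed graph on the vertex set `V`: `fixed` is the set of fixed
vertices, all other vertices are random, `dir a b` is `a → b` and `bi a b` is `a ↔ b`.
No edge has an arrowhead at a fixed vertex. -/
structure CADMG (V : Type*) where
  fixed : Finset V
  dir : V → V → Prop
  bi : V → V → Prop
  bi_symm : ∀ a b, bi a b → bi b a
  bi_irrefl : ∀ a, ¬ bi a a
  acyclic : ∀ a, ¬ Relation.TransGen dir a a
  dir_head : ∀ a b, dir a b → b ∉ fixed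
  bi_head : ∀ a b, bi a b → b ∉ fixed

/-- An acyclic directed mixed graph: all vertices are random. -/
structure ADMG (V : Type*) extends CADMG V where
  fixed_eq : fixed = ∅

/-- The three ways of traversing an edge from `a` to `b`: `a → b`, `a ← b`, `a ↔ b`. -/
inductive EdgeMark
  | fwd
  | bwd
  | both

namespace EdgeMark

/-- There is an arrowhead at the endpoint at which the traversal arrives. -/
def HeadAtEnd : EdgeMark → Prop
  | fwd => True
  | bwd => False
  | both => True

/-- There is an arrowhead at the endpoint from which the traversal departs. -/
def HeadAtStart : EdgeMark → Prop
  | fwd => False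
  | bwd => True
  | both => True

end EdgeMark

namespace CADMG

variable {V : Type*} [Fintype V] [DecidableEq V]

/-- The random vertices. -/
def random (G : CADMG V) : Finset V := Finset.univ \ G.fixed

/-- Fixing (intervening on) a set of vertices: remove all edges with an arrowhead into it. -/
def fix (G : CADMG V) (S : Finset V) : CADMG V where
  fixed := G.fixed ∪ S
  dir a b := G.dir a b ∧ b ∉ S
  bi a b := G.bi a b ∧ a ∉ S ∧ b ∉ S
  bi_symm a b h := ⟨G.bi_symm a b h.1, h.2.2, h.2.1⟩
  bi_irrefl a h := G.bi_irrefl a h.1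
  acyclic a h := G.acyclic a (Relation.TransGen.mono (fun _ _ h' => h'.1) _ _ h)
  dir_head a b h := by
    rw [Finset.mem_union, not_or]
    exact ⟨G.dir_head a b h.1, h.2⟩
  bi_head a b h := by
    rw [Finset.mem_union, not_or]
    exact ⟨G.bi_head a b h.1, h.2.2⟩

/-- Delete all edges that involve the vertex `v`. The vertex stays in the type as an isolated one,
which is immaterial for separation of other vertices. -/
def deleteVertex (G : CADMG V) (v : V) : CADMG V where
  fixed := G.fixed
  dir a b := G.dir a b ∧ a ≠ v ∧ b ≠ v
  bi a b := G.bi a b ∧ a ≠ v ∧ b ≠ v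
  bi_symm a b h := ⟨G.bi_symm a b h.1, h.2.2, h.2.1⟩
  bi_irrefl a h := G.bi_irrefl a h.1
  acyclic a h := G.acyclic a (Relation.TransGen.mono (fun _ _ h' => h'.1) _ _ h)
  dir_head a b h := G.dir_head a b h.1
  bi_head a b h := G.bi_head a b h.1

open Classical in
/-- The district of `v`: the random vertices joined to `v` by a bidirected path. -/
noncomputable def district (G : CADMG V) (v : V) : Finset V :=
  G.random.filter fun w => Relation.ReflTransGen G.bi v w

/-- The set of all districts (of random vertices). -/
noncomputable def districts (G : CADMG V) : Finset (Finset V) :=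
  G.random.image G.district

open Classical in
/-- The parents of a set of vertices. -/
noncomputable def parents (G : CADMG V) (D : Finset V) : Finset V :=
  Finset.univ.filter fun w => ∃ d ∈ D, G.dir w d

/-- The Markov blanket of `v`: its district and the parents of its district, without `v`. -/
noncomputable def markovBlanket (G : CADMG V) (v : V) : Finset V :=
  (G.district v ∪ G.parents (G.district v)).erase v

/-- A random vertex `v` is fixable if no other random vertex is both a descendant of `v` and
joined to `v` by a bidirected path. -/
def Fixable (G : CADMG V) (v : V) : Prop :=
  v ∈ G.random ∧ ∀ w ∈ G.random, w ≠ v →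
    ¬ (Relation.TransGen G.dir v w ∧ Relation.TransGen G.bi v w)

/-- Valid fixing sequences: each vertex is fixable after the earlier ones have been fixed. -/
def ValidSeq : CADMG V → List V → Prop
  | _, [] => True
  | G, v :: l => G.Fixable v ∧ ValidSeq (G.fix {v}) l

/-- A set is fixable if it can be ordered into a valid fixing sequence. -/
def FixableSet (G : CADMG V) (S : Finset V) : Prop :=
  ∃ l : List V, l.toFinset = S ∧ G.ValidSeq l

/-- `D` is intrinsic if all other random vertices can be fixed, and `D` is then the only
district. -/
def Intrinsic (G : CADMG V) (D : Finset V) : Prop :=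
  D ⊆ G.random ∧ G.FixableSet (G.random \ D) ∧ (G.fix (G.random \ D)).districts = {D}

/-- The distribution after an intervention on `S` is identified from the observed one: it is a
product of intrinsic kernels, i.e. every district of the intervened graph is intrinsic. -/
def Identified (G : CADMG V) (S : Finset V) : Prop :=
  ∀ D ∈ (G.fix S).districts, G.Intrinsic D

/-- `G` has an edge between `a` and `b` which is traversed from `a` to `b` as the mark says. -/
def Edge (G : CADMG V) : EdgeMark → V → V → Prop
  | .fwd, a, b => G.dir a b
  | .bwd, a, b => G.dir b a
  | .both, a, b => G.bi a b

/-- `x` and `y` are m-connected given `C`: there is a path `v 0, …, v n` from `x` to `y` on which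
every collider is an ancestor of (or in) `C` and no non-collider is in `C`. Fixed vertices are
constants, hence count as conditioned on. -/
def MConnected (G : CADMG V) (x y : V) (C : Finset V) : Prop :=
  ∃ (n : ℕ) (v : ℕ → V) (e : ℕ → EdgeMark),
    v 0 = x ∧ v n = y ∧ Set.InjOn v (Set.Iic n) ∧
    (∀ i < n, G.Edge (e i) (v i) (v (i + 1))) ∧
    ∀ i, i + 1 < n →
      ((e i).HeadAtEnd ∧ (e (i + 1)).HeadAtStart →
        ∃ c ∈ C, Relation.ReflTransGen G.dir (v (i + 1)) c) ∧
      (¬ ((e i).HeadAtEnd ∧ (e (i + 1)).HeadAtStart) →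
        v (i + 1) ∉ C ∧ v (i + 1) ∉ G.fixed)

/-- m-separation. -/
def MSeparated (G : CADMG V) (x y : V) (C : Finset V) : Prop := ¬ G.MConnected x y C

end CADMG

/-! ### Densities, kernels and the nested Markov factorization

A kernel `q(R | W)` with random variables `R` and fixed variables `W = V \ R` is a function of all
coordinates, and `lmarginal μ T q` integrates out the coordinates in `T`. -/

section Kernels

variable {V : Type*} [Fintype V] [DecidableEq V] {Ω : V → Type*} [∀ v, MeasurableSpace (Ω v)]

/-- `p` is an (almost everywhere) positive probability density with respect to the product of the
reference measures `μ v`. -/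
structure IsPositiveDensity (μ : ∀ v, Measure (Ω v)) (p : (∀ v, Ω v) → ℝ≥0∞) : Prop where
  measurable : Measurable p
  lintegral_eq_one : ∫⁻ x, p x ∂(Measure.pi μ) = 1
  pos : ∀ᵐ x ∂(Measure.pi μ), 0 < p x

/-- `q(v | B, W)` for a kernel `q(R | W)`. -/
noncomputable def condDensity (μ : ∀ v, Measure (Ω v)) (R : Finset V) (q : (∀ v, Ω v) → ℝ≥0∞)
    (v : V) (B : Finset V) : (∀ v, Ω v) → ℝ≥0∞ :=
  fun x => lmarginal μ (R \ insert v B) q x / lmarginal μ (R \ B) q x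

/-- `X_a` and `X_b` are independent given `X_C` in the kernel `q(R | W)`, for each value of `W`:
`q(a,b,C | W) q(C | W) = q(a,C | W) q(b,C | W)`. -/
def KernelIndep (μ : ∀ v, Measure (Ω v)) (R : Finset V) (q : (∀ v, Ω v) → ℝ≥0∞)
    (a b : V) (C : Finset V) : Prop :=
  ∀ᵐ x ∂(Measure.pi μ),
    lmarginal μ (R \ insert a (insert b C)) q x * lmarginal μ (R \ C) q x =
      lmarginal μ (R \ insert a C) q x * lmarginal μ (R \ insert b C) q x

/-- Ordinary conditional independence of `X_a` and `X_b` given `X_C` in `p(V)`. -/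
def OrdIndep (μ : ∀ v, Measure (Ω v)) (p : (∀ v, Ω v) → ℝ≥0∞) (a b : V) (C : Finset V) : Prop :=
  KernelIndep μ Finset.univ p a b C

/-- Fixing the vertex `v` in the kernel `q` with graph `G`: division by
`q(v | mb(v), W)`. -/
noncomputable def fixKernel (μ : ∀ v, Measure (Ω v)) (G : CADMG V) (q : (∀ v, Ω v) → ℝ≥0∞)
    (v : V) : (∀ v, Ω v) → ℝ≥0∞ :=
  fun x => q x / condDensity μ G.random q v (G.markovBlanket v) x

/-- Fixing the vertices of a list one after the other. -/
noncomputable def fixKernelSeq (μ : ∀ v, Measure (Ω v)) :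
    CADMG V → ((∀ v, Ω v) → ℝ≥0∞) → List V → (∀ v, Ω v) → ℝ≥0∞
  | _, q, [] => q
  | G, q, v :: l => fixKernelSeq μ (G.fix {v}) (fixKernel μ G q v) l

/-- `q` is a kernel `q(D | P)`: it depends on `D ∪ P` only and is a normalized density over `D`
for each value of the other coordinates. -/
structure IsKernel (μ : ∀ v, Measure (Ω v)) (D P : Finset V) (q : (∀ v, Ω v) → ℝ≥0∞) :
    Prop where
  measurable : Measurable q
  dependsOn : DependsOn q ((D ∪ P : Finset V) : Set V)
  normalized : ∀ x, lmarginal μ D q x = 1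

/-- The nested Markov factorization of `p(V)` with respect to an ADMG. -/
def NestedMarkov (μ : ∀ v, Measure (Ω v)) (p : (∀ v, Ω v) → ℝ≥0∞) (G : ADMG V) : Prop :=
  ∃ q : Finset V → (∀ v, Ω v) → ℝ≥0∞,
    (∀ D, G.Intrinsic D → IsKernel μ D (G.parents D) (q D)) ∧
    ∀ l : List V, G.ValidSeq l →
      ∀ᵐ x ∂(Measure.pi μ), fixKernelSeq μ G.toCADMG p l x =
        ∏ D ∈ (G.fix l.toFinset).districts, q D x

/-- `ord` is a topological (causal) order of the vertices of `G`. -/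
def TopologicalOrder (G : ADMG V) (ord : V → ℕ) : Prop :=
  Function.Injective ord ∧ ∀ a b, G.dir a b → ord a < ord b

/-- The post-intervention kernel `p(V) / ∏_{s ∈ S} p(s | predecessors of s)` which the g-formula
computes from `p(V)` along an order of the vertices. -/
noncomputable def gFormula (μ : ∀ v, Measure (Ω v)) (ord : V → ℕ) (S : Finset V)
    (p : (∀ v, Ω v) → ℝ≥0∞) : (∀ v, Ω v) → ℝ≥0∞ :=
  fun x => p x /
    ∏ s ∈ S, condDensity μ Finset.univ p s (Finset.univ.filter fun w => ord w < ord s) x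

/-- Verma faithfulness of `p` to `G`. Ordinary independences in `p` are m-separations in `G`; and
an independence of two variables in a post-intervention kernel obtained from `p`, if these
variables satisfy no ordinary independence in `p`, implies that the post-intervention distribution
is identified in `G` and that they are m-separated in the corresponding CADMG.
(For sets of variables m-separation is pairwise, so pairs suffice.) -/
structure VermaFaithful (μ : ∀ v, Measure (Ω v)) (p : (∀ v, Ω v) → ℝ≥0∞) (G : ADMG V) :
    Prop where
  ordinary : ∀ (a b : V) (C : Finset V), a ≠ b → a ∉ C → b ∉ C →
    OrdIndep μ p a b C → G.MSeparated a b C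
  generalized : ∀ ord : V → ℕ, TopologicalOrder G ord →
    ∀ (S : Finset V) (a b : V) (C : Finset V),
    a ≠ b → a ∉ S → b ∉ S → a ∉ C → b ∉ C → Disjoint C S →
    (∀ C' : Finset V, a ∉ C' → b ∉ C' → ¬ OrdIndep μ p a b C') →
    KernelIndep μ (Finset.univ \ S) (gFormula μ ord S p) a b C →
    G.Identified S ∧ (G.fix S).MSeparated a b C

end Kernels

/-! ### The four variables -/

/-- Anchor `Z`, treatment `A`, mediator `M`, outcome `Y`. -/
inductive Var
  | Z
  | A
  | M
  | Y
  deriving DecidableEq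

instance : Fintype Var where
  elems := {.Z, .A, .M, .Y}
  complete := by intro v; cases v <;> simp

/-- (A1) `M` is a mediator between `A` and `Y`: the path `A → M → Y` is present. -/
def Mediation (G : ADMG Var) : Prop := G.dir .A .M ∧ G.dir .M .Y

/-- (A2) `Z` is not a causal consequence of `A`, `Z` and `A` are dependent, and so are
`Z` and `Y` given `A, M`. -/
def Anchor {Ω : Var → Type*} [∀ v, MeasurableSpace (Ω v)] (μ : ∀ v, Measure (Ω v))
    (p : (∀ v, Ω v) → ℝ≥0∞) (G : ADMG Var) : Prop :=
  ¬ Relation.TransGen G.dir .A .Z ∧ ¬ OrdIndep μ p .Z .A ∅ ∧ ¬ OrdIndep μ p .Z .Y {.A, .M}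

/-- The Verma constraint: `Z` and `Y` are independent in the kernel `p(Z,A,M,Y) / p(M | A,Z)`,
in which `Z, A, Y` are random and `M` is fixed. -/
def VermaConstraint {Ω : Var → Type*} [∀ v, MeasurableSpace (Ω v)] (μ : ∀ v, Measure (Ω v))
    (p : (∀ v, Ω v) → ℝ≥0∞) : Prop :=
  KernelIndep μ {.Z, .A, .Y} (fun x => p x / condDensity μ Finset.univ p .M {.A, .Z} x) .Z .Y ∅

/-- (F1) exclusion restriction. -/
def FrontDoor1 (G : ADMG Var) : Prop := ¬ G.dir .A .Y

/-- (F2) no unmeasured confounding of treatment and mediator or of mediator and outcome. -/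
def FrontDoor2 (G : ADMG Var) : Prop := ¬ G.bi .A .M ∧ ¬ G.bi .M .Y

/-- (I1) `Z → A` or `Z ↔ A`. -/
def Instrument1 (G : ADMG Var) : Prop := G.dir .Z .A ∨ G.bi .Z .A

/-- (I2) `Z` and `Y` are m-separated in the subgraph without `A`. -/
def Instrument2 (G : ADMG Var) : Prop := (G.deleteVertex .A).MSeparated .Z .Y ∅

/-! By acyclicity, (A1) and (A2) force the causal order Z, A, M, Y. The factorization turns missing
edges into independences, which (A2) excludes; faithfulness turns independences into missing edges.
If Z and A were not adjacent, fixing Y and M would leave p(Z,A) = q(Z) q(A), against (A2)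
(`ordIndep_Z_A`). This rests on `fixKernelSeq_childless`: for a childless v only the factor of its
own district involves v, so division by q(v | mb(v)) integrates v out. Hence some edge between Z and
A has its arrowhead at A, and this edge carries all later paths. Separation of Z and M given A
excludes edges between Z and M, and A ↔ M, since A is a conditioned collider. No set C makes Z and Y
independent. If C misses A and M, the path through A → M → Y is open. Otherwise the collider A is
open, so A ↔ Y is absent, and the factorization yields Z ⊥ Y | A, M (`ordIndep_Z_Y`), against (A2).
The Verma constraint therefore falls under generalized faithfulness. Separation of Z and Y after
fixing M excludes edges between Z and Y, and A → Y. Identification excludes M ↔ Y: M cannot be fixed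
while Y, a child in its own district, is random (`Intrinsic.not_bi_of_dir`). Only A is left as a
neighbour of Z, whence (I2). -/

set_option linter.unusedSectionVars false

/-! ### Fixing vertices in mixed graphs -/

namespace CADMG

variable {V : Type*} [Fintype V] [DecidableEq V]

theorem eq_of_edges_eq {G H : CADMG V} (hf : G.fixed = H.fixed)
    (hd : ∀ a b, G.dir a b ↔ H.dir a b) (hb : ∀ a b, G.bi a b ↔ H.bi a b) : G = H := by
  obtain ⟨f, d, b, _, _, _, _, _⟩ := G
  obtain ⟨f', d', b', _, _, _, _, _⟩ := H
  obtain rfl : f = f' := hf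
  obtain rfl : d = d' := by
    ext x y
    exact hd x y
  obtain rfl : b = b' := by
    ext x y
    exact hb x y
  rfl

theorem fix_fix (G : CADMG V) (S T : Finset V) : (G.fix S).fix T = G.fix (S ∪ T) :=
  eq_of_edges_eq (by simp [fix, Finset.union_assoc])
    (fun a b => by simp only [fix, Finset.mem_union]; tauto)
    (fun a b => by simp only [fix, Finset.mem_union]; tauto)

theorem fix_empty (G : CADMG V) : G.fix ∅ = G :=
  eq_of_edges_eq (by simp [fix]) (fun a b => by simp [fix]) (fun a b => by simp [fix])

theorem mem_random {G : CADMG V} {v : V} : v ∈ G.random ↔ v ∉ G.fixed := by simp [random]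

theorem random_fix (G : CADMG V) (S : Finset V) : (G.fix S).random = G.random \ S := by
  ext v
  simp [random, fix]

theorem mem_district {G : CADMG V} {v w : V} :
    w ∈ G.district v ↔ w ∈ G.random ∧ Relation.ReflTransGen G.bi v w := by
  simp [district]

theorem mem_districts {G : CADMG V} {D : Finset V} :
    D ∈ G.districts ↔ ∃ v ∈ G.random, G.district v = D := by
  simp [districts]

theorem mem_parents {G : CADMG V} {D : Finset V} {w : V} :
    w ∈ G.parents D ↔ ∃ d ∈ D, G.dir w d := by
  simp [parents]

theorem reflTransGen_bi_symm {G : CADMG V} {v w : V} (h : Relation.ReflTransGen G.bi v w) :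
    Relation.ReflTransGen G.bi w v := by
  induction h with
  | refl => exact .refl
  | tail _ h ih => exact .head (G.bi_symm _ _ h) ih

theorem district_eq_of_mem {G : CADMG V} {v w : V} (h : w ∈ G.district v) :
    G.district w = G.district v := by
  rw [mem_district] at h
  ext u
  simp only [mem_district]
  exact and_congr_right fun _ => ⟨h.2.trans, (reflTransGen_bi_symm h.2).trans⟩

theorem mem_district_self {G : CADMG V} {v : V} (h : v ∈ G.random) : v ∈ G.district v :=
  mem_district.2 ⟨h, .refl⟩

theorem district_subset_random (G : CADMG V) (v : V) : G.district v ⊆ G.random :=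
  fun _ h => (mem_district.1 h).1

theorem subset_random_of_mem_districts {G : CADMG V} {D : Finset V} (hD : D ∈ G.districts) :
    D ⊆ G.random := by
  obtain ⟨v, _, rfl⟩ := mem_districts.1 hD
  exact G.district_subset_random v

theorem mem_district_of_bi {G : CADMG V} {v a b : V} (h : G.bi a b) (ha : a ∈ G.district v) :
    b ∈ G.district v :=
  mem_district.2 ⟨mem_random.2 (G.bi_head a b h), (mem_district.1 ha).2.tail h⟩

theorem district_fix_random_sdiff {G : CADMG V} {v w : V} (hw : w ∈ G.district v) :
    (G.fix (G.random \ G.district v)).district w = G.district v := by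
  ext u
  have hmem : ∀ a ∈ G.district v, a ∉ G.random \ G.district v := fun a ha h =>
    (Finset.mem_sdiff.1 h).2 ha
  rw [mem_district, random_fix]
  constructor
  · rintro ⟨hu, -⟩
    rw [Finset.mem_sdiff, Finset.mem_sdiff, not_and_not_right] at hu
    exact hu.2 hu.1
  · intro hu
    refine ⟨Finset.mem_sdiff.2 ⟨G.district_subset_random v hu, hmem u hu⟩, ?_⟩
    have hwu : u ∈ G.district w := by rwa [district_eq_of_mem hw]
    have := (mem_district.1 hwu).2
    clear hu hwu
    -- Membership is carried along the path: an edge survives the fixing only because both of its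
    -- ends lie in the district.
    suffices h : ∀ u, Relation.ReflTransGen G.bi w u → u ∈ G.district v ∧
        Relation.ReflTransGen (G.fix (G.random \ G.district v)).bi w u from (h u this).2
    intro u hu
    induction hu with
    | refl => exact ⟨hw, .refl⟩
    | tail _ h ih =>
      have hb := mem_district_of_bi h ih.1
      exact ⟨hb, ih.2.tail ⟨h, hmem _ ih.1, hmem _ hb⟩⟩

theorem districts_fix_random_sdiff {G : CADMG V} {D : Finset V} (hD : D ∈ G.districts) :
    (G.fix (G.random \ D)).districts = {D} := by
  obtain ⟨v, hv, rfl⟩ := mem_districts.1 hD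
  have hr : (G.fix (G.random \ G.district v)).random = G.district v := by
    rw [random_fix, Finset.sdiff_sdiff_eq_self (G.district_subset_random v)]
  ext E
  rw [mem_districts, hr, Finset.mem_singleton]
  constructor
  · rintro ⟨w, hw, rfl⟩
    exact district_fix_random_sdiff hw
  · rintro rfl
    exact ⟨v, mem_district_self hv, district_fix_random_sdiff (mem_district_self hv)⟩

/-! ### Fixability of complements and intrinsic sets -/

theorem exists_last {G : CADMG V} {S : Finset V} (hS : S.Nonempty) :
    ∃ v ∈ S, ∀ w ∈ S, ¬ Relation.TransGen G.dir v w := by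
  let r : V → V → Prop := fun a b => Relation.TransGen G.dir b a
  have : IsTrans V r := ⟨fun _ _ _ hab hbc => hbc.trans hab⟩
  have : Std.Irrefl r := ⟨fun a h => G.acyclic a h⟩
  obtain ⟨v, hv, h⟩ := (Finite.wellFounded_of_trans_of_irrefl r).has_min (S : Set V) hS
  exact ⟨v, hv, h⟩

/-- The complement of a union of districts is fixable. -/
theorem fixableSet_random_sdiff (G : CADMG V) (D : Finset V)
    (hD : ∀ a b, G.bi a b → a ∈ D → b ∈ D) : G.FixableSet (G.random \ D) := by
  induction hn : (G.random \ D).card generalizing G with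
  | zero => exact ⟨[], by simpa using (Finset.card_eq_zero.1 hn).symm, trivial⟩
  | succ n ih =>
    obtain ⟨v, hv, hlast⟩ := exists_last (G := G) (S := G.random \ D) (Finset.card_pos.1 (by omega))
    have hvD := Finset.mem_sdiff.1 hv
    have hfix : G.Fixable v := by
      refine ⟨hvD.1, fun w hw _ h => hlast w (Finset.mem_sdiff.2 ⟨hw, fun hwD => ?_⟩) h.1⟩
      -- The complement of `D` is closed under bidirected edges, while `v` has no random descendant
      -- outside `D`; so no other random vertex violates fixability.
      suffices hh : ∀ u, Relation.TransGen G.bi v u → u ∉ D from hh w h.2 hwD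
      intro u hu
      induction hu with
      | single h => exact fun hu => hvD.2 (hD _ _ (G.bi_symm _ _ h) hu)
      | tail _ h ih => exact fun hu => ih (hD _ _ (G.bi_symm _ _ h) hu)
    have hr : (G.fix {v}).random \ D = (G.random \ D).erase v := by
      ext w
      simp only [random_fix, Finset.mem_sdiff, Finset.mem_singleton, Finset.mem_erase]
      tauto
    obtain ⟨l, hl, hval⟩ := ih (G.fix {v}) (fun a b h => hD a b h.1)
      (by rw [hr, Finset.card_erase_of_mem hv, hn]; rfl)
    refine ⟨v :: l, ?_, hfix, hval⟩
    rw [List.toFinset_cons, hl, hr, Finset.insert_erase hv]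

theorem ValidSeq.append {G : CADMG V} {l l' : List V} (h : G.ValidSeq l)
    (h' : (G.fix l.toFinset).ValidSeq l') : G.ValidSeq (l ++ l') := by
  induction l generalizing G with
  | nil => simpa [fix_empty] using h'
  | cons v l ih =>
    refine ⟨h.1, ih h.2 ?_⟩
    rwa [fix_fix, ← Finset.insert_eq, ← List.toFinset_cons]

theorem ValidSeq.subset_random {G : CADMG V} {l : List V} (h : G.ValidSeq l) :
    l.toFinset ⊆ G.random := by
  induction l generalizing G with
  | nil => simp
  | cons v l ih =>
    rw [List.toFinset_cons, Finset.insert_subset_iff]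
    exact ⟨h.1.1, (ih h.2).trans (by rw [random_fix]; exact Finset.sdiff_subset)⟩

/-- The districts of the graph after a valid fixing sequence are intrinsic. -/
theorem ValidSeq.intrinsic {G : CADMG V} {l : List V} (h : G.ValidSeq l) {D : Finset V}
    (hD : D ∈ (G.fix l.toFinset).districts) : G.Intrinsic D := by
  have hDr := subset_random_of_mem_districts hD
  -- The vertices outside `D` are fixed in two stages: along `l`, then those still random.
  have hr : G.random \ D = l.toFinset ∪ ((G.fix l.toFinset).random \ D) := by
    rw [random_fix] at hDr ⊢
    ext w
    have h1 := @hDr w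
    have h2 := @h.subset_random _ _ _ _ _ w
    simp only [Finset.mem_union, Finset.mem_sdiff] at h1 h2 ⊢
    tauto
  refine ⟨hDr.trans (by rw [random_fix]; exact Finset.sdiff_subset), ?_, ?_⟩
  · obtain ⟨v, _, rfl⟩ := mem_districts.1 hD
    obtain ⟨l', hl', hv'⟩ := fixableSet_random_sdiff _ _
      fun a b hab => mem_district_of_bi (v := v) hab
    exact ⟨l ++ l', by rw [List.toFinset_append, hl', hr], h.append hv'⟩
  · rw [hr, ← fix_fix]
    exact districts_fix_random_sdiff hD

/-- A vertex with a child in its own district cannot be fixed while the child is random. -/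
theorem not_mem_of_validSeq {G : CADMG V} {l : List V} (h : G.ValidSeq l) {v w : V}
    (hd : G.dir v w) (hb : G.bi v w) (hw : w ∉ l) : v ∉ l := by
  induction l generalizing G with
  | nil => simp
  | cons u l ih =>
    rw [List.mem_cons, not_or] at hw ⊢
    have hne : w ≠ v := fun e => G.bi_irrefl v (e ▸ hb)
    have hvu : v ≠ u := by
      rintro rfl
      exact h.1.2 w (mem_random.2 (G.dir_head _ _ hd)) hne ⟨.single hd, .single hb⟩
    exact ⟨hvu, ih h.2 ⟨hd, by simpa using hw.1⟩ ⟨hb, by simpa using hvu, by simpa using hw.1⟩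
      hw.2⟩

/-- Reaching `D` requires fixing `v` while `w` stays random, but then `w` is both a descendant of
`v` and in its district. -/
theorem Intrinsic.not_bi_of_dir {G : CADMG V} {D : Finset V} (hD : G.Intrinsic D) {v w : V}
    (hd : G.dir v w) (hw : w ∈ D) (hv : v ∉ D) : ¬ G.bi v w := by
  intro hb
  obtain ⟨-, ⟨l, hl, hval⟩, -⟩ := hD
  have hmem : ∀ u, u ∈ l ↔ u ∈ G.random \ D := fun u => by rw [← hl, List.mem_toFinset]
  refine not_mem_of_validSeq hval hd hb (by simp [hmem, hw]) ((hmem v).2 ?_)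
  exact Finset.mem_sdiff.2 ⟨mem_random.2 (G.bi_head _ _ (G.bi_symm _ _ hb)), hv⟩

/-! ### Short m-connecting paths -/

theorem mConnected_of_edge {G : CADMG V} {e : EdgeMark} {a b : V} {C : Finset V} (hab : a ≠ b)
    (h : G.Edge e a b) : G.MConnected a b C := by
  refine ⟨1, fun | 0 => a | _ => b, fun _ => e, rfl, rfl, ?_, ?_, fun i hi => by omega⟩
  · intro i hi j hj hij
    simp only [Set.mem_Iic] at hi hj
    interval_cases i <;> interval_cases j <;> simp_all
  · intro i hi
    interval_cases i
    exact h

/-- The inner vertex `b` of a path is open given `C` when it is entered by the edge `e` and left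
by the edge `e'`. -/
def OpenAt (G : CADMG V) (C : Finset V) (e e' : EdgeMark) (b : V) : Prop :=
  (e.HeadAtEnd ∧ e'.HeadAtStart → ∃ c ∈ C, Relation.ReflTransGen G.dir b c) ∧
    (¬ (e.HeadAtEnd ∧ e'.HeadAtStart) → b ∉ C ∧ b ∉ G.fixed)

theorem openAt_collider {G : CADMG V} {C : Finset V} {e e' : EdgeMark} {b c : V}
    (he : e.HeadAtEnd) (he' : e'.HeadAtStart) (hc : c ∈ C)
    (h : Relation.ReflTransGen G.dir b c) : G.OpenAt C e e' b :=
  ⟨fun _ => ⟨c, hc, h⟩, fun hn => (hn ⟨he, he'⟩).elim⟩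

/-- A vertex left through the tail of an edge is never a collider, whatever the entering edge. -/
theorem openAt_fwd {G : CADMG V} {C : Finset V} {e : EdgeMark} {b : V}
    (hC : b ∉ C) (hf : b ∉ G.fixed) : G.OpenAt C e .fwd b :=
  ⟨fun h => h.2.elim, fun _ => ⟨hC, hf⟩⟩

theorem mConnected_of_two_edges {G : CADMG V} {e e' : EdgeMark} {a b c : V} {C : Finset V}
    (hab : a ≠ b) (hac : a ≠ c) (hbc : b ≠ c) (h : G.Edge e a b) (h' : G.Edge e' b c)
    (ho : G.OpenAt C e e' b) : G.MConnected a c C := by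
  refine ⟨2, fun | 0 => a | 1 => b | _ => c, fun | 0 => e | _ => e', rfl, rfl, ?_, ?_, ?_⟩
  · intro i hi j hj hij
    simp only [Set.mem_Iic] at hi hj
    interval_cases i <;> interval_cases j <;> simp_all
  · intro i hi
    interval_cases i
    exacts [h, h']
  · intro i hi
    obtain rfl : i = 0 := by omega
    exact ho

theorem mConnected_of_three_edges {G : CADMG V} {e e' e'' : EdgeMark} {a b c d : V}
    {C : Finset V} (hab : a ≠ b) (hac : a ≠ c) (had : a ≠ d) (hbc : b ≠ c) (hbd : b ≠ d)
    (hcd : c ≠ d) (h : G.Edge e a b) (h' : G.Edge e' b c) (h'' : G.Edge e'' c d)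
    (hb : G.OpenAt C e e' b) (hc : G.OpenAt C e' e'' c) : G.MConnected a d C := by
  refine ⟨3, fun | 0 => a | 1 => b | 2 => c | _ => d, fun | 0 => e | 1 => e' | _ => e'',
    rfl, rfl, ?_, ?_, ?_⟩
  · intro i hi j hj hij
    simp only [Set.mem_Iic] at hi hj
    interval_cases i <;> interval_cases j <;> simp_all
  · intro i hi
    interval_cases i
    exacts [h, h', h'']
  · intro i hi
    obtain rfl | rfl : i = 0 ∨ i = 1 := by omega
    exacts [hb, hc]

/-- A vertex without edges is m-separated from every other vertex. -/
theorem mSeparated_of_isolated {G : CADMG V} {a b : V} {C : Finset V} (hab : a ≠ b)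
    (h : ∀ e w, ¬ G.Edge e a w) : G.MSeparated a b C := by
  rintro ⟨n, v, e, h0, hn, -, hE, -⟩
  rcases Nat.eq_zero_or_pos n with rfl | hpos
  · exact hab (h0.symm.trans hn)
  · exact h (e 0) (v 1) (h0 ▸ hE 0 hpos)

end CADMG

/-! ### Marginals of densities -/

section Marginals

variable {V : Type*} [Fintype V] [DecidableEq V] {Ω : V → Type*} [∀ v, MeasurableSpace (Ω v)]
  {μ : ∀ v, Measure (Ω v)}

theorem lmarginal_zero (s : Finset V) : lmarginal μ s (fun _ => 0) = fun _ => 0 := by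
  ext x
  simp [lmarginal]

theorem DependsOn.lmarginal {f : (∀ v, Ω v) → ℝ≥0∞} {T : Set V} (hf : DependsOn f T)
    (s : Finset V) : DependsOn (lmarginal μ s f) T := by
  intro x y hxy
  refine lintegral_congr fun z => hf fun i hi => ?_
  simp only [Function.updateFinset]
  split_ifs
  · rfl
  · exact hxy i hi

theorem DependsOn.finset_prod {ι M : Type*} [CommMonoid M] {s : Finset ι}
    {f : ι → (∀ v, Ω v) → M} {T : Set V} (hf : ∀ i ∈ s, DependsOn (f i) T) :
    DependsOn (fun x => ∏ i ∈ s, f i x) T :=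
  fun _ _ h => Finset.prod_congr rfl fun i hi => hf i hi h

theorem lmarginal_mul_left {f g : (∀ v, Ω v) → ℝ≥0∞} {s : Finset V} {T : Set V}
    (hf : DependsOn f T) (hT : Disjoint T s) (hg : Measurable g) :
    lmarginal μ s (fun x => f x * g x) = fun x => f x * lmarginal μ s g x := by
  ext x
  have h : ∀ y : ∀ i : s, Ω i, f (Function.updateFinset x s y) = f x := fun y =>
    hf fun i hi => by
      have : i ∉ s := fun h => Set.disjoint_left.1 hT hi h
      simp [Function.updateFinset, this]
  simp only [lmarginal, h]
  exact lintegral_const_mul _ (hg.comp measurable_updateFinset)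

theorem lmarginal_mul_right {f g : (∀ v, Ω v) → ℝ≥0∞} {s : Finset V} {T : Set V}
    (hg : DependsOn g T) (hT : Disjoint T s) (hf : Measurable f) :
    lmarginal μ s (fun x => f x * g x) = fun x => lmarginal μ s f x * g x := by
  simp only [mul_comm _ (g _)]
  exact lmarginal_mul_left hg hT hf

/-! ### Fubini and almost everywhere identities -/

variable [∀ v, SigmaFinite (μ v)]

theorem lmarginal_compl_lmarginal {f : (∀ v, Ω v) → ℝ≥0∞} (hf : Measurable f) (s : Finset V)
    (x : ∀ v, Ω v) : lmarginal μ sᶜ (lmarginal μ s f) x = ∫⁻ y, f y ∂(Measure.pi μ) := by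
  rw [lintegral_eq_lmarginal_univ x, ← lmarginal_union μ f hf disjoint_compl_left,
    Finset.union_comm, Finset.union_compl]

/-- Vanishing of the marginal over the coordinates outside `s`, for every value of the
coordinates in `s`, forces a function to vanish almost everywhere. -/
theorem ae_eq_zero_of_lmarginal_compl {f : (∀ v, Ω v) → ℝ≥0∞} (hf : Measurable f) (s : Finset V)
    (h : ∀ x, lmarginal μ sᶜ f x = 0) : ∀ᵐ x ∂(Measure.pi μ), f x = 0 := by
  rcases isEmpty_or_nonempty (∀ v, Ω v) with _ | ⟨⟨x⟩⟩
  · exact .of_forall fun x => isEmptyElim x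
  refine (lintegral_eq_zero_iff hf).1 ?_
  have h0 : lmarginal μ sᶜ f = fun _ => 0 := funext h
  rw [← lmarginal_compl_lmarginal hf sᶜ x, h0, lmarginal_zero]

/-- A property that holds almost everywhere holds almost everywhere on almost every slice. -/
theorem ae_ae_updateFinset {P : (∀ v, Ω v) → Prop} (hP : ∀ᵐ x ∂(Measure.pi μ), P x)
    (s : Finset V) : ∀ᵐ x ∂(Measure.pi μ), ∀ᵐ y ∂(Measure.pi fun i : s => μ i),
      P (Function.updateFinset x s y) := by
  -- `P` need not be measurable; the indicator of a measurable null hull of its exceptional set can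
  -- be integrated slice by slice.
  set N := toMeasurable (Measure.pi μ) {x | ¬ P x}
  have hN : MeasurableSet N := measurableSet_toMeasurable _ _
  have hm : Measurable (N.indicator fun _ => (1 : ℝ≥0∞)) := measurable_const.indicator hN
  have h0 : ∫⁻ x, N.indicator (fun _ => (1 : ℝ≥0∞)) x ∂(Measure.pi μ) = 0 := by
    rw [lintegral_indicator_const hN, one_mul, measure_toMeasurable]
    exact hP
  have := ae_eq_zero_of_lmarginal_compl (hm.lmarginal μ (s := s)) s fun x => by
    rw [lmarginal_compl_lmarginal hm, h0]
  filter_upwards [this] with x hx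
  have hx' := (lintegral_eq_zero_iff (hm.comp measurable_updateFinset)).1 hx
  filter_upwards [hx'] with y hy
  by_contra hPy
  have hmem : Function.updateFinset x s y ∈ N := subset_toMeasurable _ _ hPy
  simp [hmem] at hy

theorem lmarginal_congr_ae {f g : (∀ v, Ω v) → ℝ≥0∞}
    (h : ∀ᵐ x ∂(Measure.pi μ), f x = g x) (s : Finset V) :
    ∀ᵐ x ∂(Measure.pi μ), lmarginal μ s f x = lmarginal μ s g x := by
  filter_upwards [ae_ae_updateFinset h s] with x hx
  exact lintegral_congr_ae hx

theorem IsPositiveDensity.lmarginal_ne_zero {p : (∀ v, Ω v) → ℝ≥0∞} (hp : IsPositiveDensity μ p)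
    (s : Finset V) : ∀ᵐ x ∂(Measure.pi μ), lmarginal μ s p x ≠ 0 := by
  filter_upwards [ae_ae_updateFinset hp.pos s] with x hx h0
  have h1 := (lintegral_eq_zero_iff (hp.measurable.comp measurable_updateFinset)).1 h0
  -- A density both positive and zero almost everywhere on the slice forces the slice measure to be
  -- zero; then every marginal over `s` vanishes, against total mass one.
  have hfalse : ∀ᵐ _ ∂(Measure.pi fun i : s => μ i), False := by
    filter_upwards [hx, h1] with y hy hy'
    exact hy.ne' hy'
  have hzero : (Measure.pi fun i : s => μ i) = 0 :=
    ae_eq_bot.1 (Filter.eventually_false_iff_eq_bot.1 hfalse)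
  have hs : lmarginal μ s p = fun _ => 0 := by
    ext x
    simp [lmarginal, hzero]
  have := lmarginal_compl_lmarginal (μ := μ) hp.measurable s x
  rw [hs, lmarginal_zero, hp.lintegral_eq_one] at this
  exact zero_ne_one this

/-- The marginal integrates to one over the remaining coordinates, so it is infinite only on a null
set. -/
theorem IsPositiveDensity.lmarginal_ne_top {p : (∀ v, Ω v) → ℝ≥0∞} (hp : IsPositiveDensity μ p)
    (s : Finset V) : ∀ᵐ x ∂(Measure.pi μ), lmarginal μ s p x ≠ ∞ := by
  have hm := hp.measurable.lmarginal μ (s := s)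
  set N := {x | lmarginal μ s p x = ∞}
  have hN : MeasurableSet N := hm (measurableSet_singleton ∞)
  have hI : Measurable (N.indicator fun _ => (1 : ℝ≥0∞)) := measurable_const.indicator hN
  have := ae_eq_zero_of_lmarginal_compl (μ := μ) hI s fun x => by
    have hfin : ∫⁻ y : ∀ i : (sᶜ : Finset V), Ω i,
        lmarginal μ s p (Function.updateFinset x sᶜ y) ∂(Measure.pi fun i : (sᶜ : Finset V) => μ i) ≠ ∞ := by
      have h := lmarginal_compl_lmarginal (μ := μ) hp.measurable s x
      rw [hp.lintegral_eq_one] at h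
      exact ne_of_eq_of_ne h ENNReal.one_ne_top
    refine (lintegral_eq_zero_iff (hI.comp measurable_updateFinset)).2 ?_
    filter_upwards [ae_lt_top (hm.comp measurable_updateFinset) hfin] with y hy
    exact Set.indicator_of_notMem (fun h : Function.updateFinset x sᶜ y ∈ N => hy.ne h) _
  filter_upwards [this] with x hx hx'
  have hmem : x ∈ N := hx'
  simp [hmem] at hx

/-- If `p(V) = f g` where `f` does not depend on `b` and `g` does not depend on `a`, then `a` and
`b` are independent given all other variables. -/
theorem ordIndep_of_factorization {p f g : (∀ v, Ω v) → ℝ≥0∞} (hf : Measurable f)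
    (hg : Measurable g) (hpfg : ∀ᵐ x ∂(Measure.pi μ), p x = f x * g x) {a b : V} {C : Finset V}
    (hab : a ≠ b) (ha : a ∉ C) (hb : b ∉ C) (hC : insert a (insert b C) = Finset.univ)
    (hfb : DependsOn f {b}ᶜ) (hga : DependsOn g {a}ᶜ) : OrdIndep μ p a b C := by
  have hmem : ∀ w, w = a ∨ w = b ∨ w ∈ C := fun w => by
    have hw := Finset.mem_univ w
    rw [← hC] at hw
    simpa using hw
  have e1 : Finset.univ \ insert a C = {b} := by
    ext w
    grind
  have e2 : Finset.univ \ insert b C = {a} := by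
    ext w
    grind
  have e3 : Finset.univ \ C = {b} ∪ {a} := by
    ext w
    grind
  have d : ∀ c : V, Disjoint ({c}ᶜ : Set V) (({c} : Finset V) : Set V) := fun c => by
    simp
  have ma : lmarginal μ {a} (fun x => f x * g x) = fun x => lmarginal μ {a} f x * g x :=
    lmarginal_mul_right hga (d a) hf
  have mb : lmarginal μ {b} (fun x => f x * g x) = fun x => f x * lmarginal μ {b} g x :=
    lmarginal_mul_left hfb (d b) hg
  have mab : lmarginal μ ({b} ∪ {a}) (fun x => f x * g x) =
      fun x => lmarginal μ {a} f x * lmarginal μ {b} g x := by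
    rw [lmarginal_union μ (fun x => f x * g x) (hf.mul hg) (by simpa using hab.symm), ma]
    exact lmarginal_mul_left (hfb.lmarginal _) (d b) hg
  unfold OrdIndep KernelIndep
  rw [e1, e2, e3, hC, Finset.sdiff_self, lmarginal_empty]
  filter_upwards [hpfg, lmarginal_congr_ae hpfg {a}, lmarginal_congr_ae hpfg {b},
    lmarginal_congr_ae hpfg ({b} ∪ {a})] with x h1 h2 h3 h4
  -- Both sides become f · g · ∫ f da · ∫ g db.
  rw [h1, h2, h3, h4, ma, mb, mab]
  ring

/-- Cancellation behind fixing: `F` stands for the integral of `f` over v, `H` for that of `g` over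
the variables outside v and its blanket. The bounds on the two products pass to `f`, `F` and `H`;
`g` may be arbitrary. -/
theorem ENNReal.div_div_mul_eq {f g F H : ℝ≥0∞} (h0 : f * H ≠ 0) (h1 : f * H ≠ ∞)
    (h2 : F * H ≠ 0) (h3 : F * H ≠ ∞) : f * g / (f * H / (F * H)) = F * g := by
  have hH0 : H ≠ 0 := right_ne_zero_of_mul h0
  have hf0 : f ≠ 0 := left_ne_zero_of_mul h0
  have hF0 : F ≠ 0 := left_ne_zero_of_mul h2
  have hHt : H ≠ ∞ := fun h => h1 (by rw [h, ENNReal.mul_top hf0])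
  have hft : f ≠ ∞ := fun h => h1 (by rw [h, ENNReal.top_mul hH0])
  have hFt : F ≠ ∞ := fun h => h3 (by rw [h, ENNReal.top_mul hH0])
  rw [ENNReal.mul_div_mul_right _ _ hH0 hHt, ENNReal.div_eq_inv_mul,
    ENNReal.inv_div (.inl hFt) (.inl hF0), ENNReal.div_eq_inv_mul]
  calc f⁻¹ * F * (f * g) = f⁻¹ * f * (F * g) := by ring
    _ = F * g := by rw [ENNReal.inv_mul_cancel hf0 hft, one_mul]

/-- If `q = f g` where `f` depends on `v` and `B` only and `g` does not depend on `v`, then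
division by `q(v | B, W)` integrates `v` out. -/
theorem div_condDensity_eq_lmarginal {q f g : (∀ v, Ω v) → ℝ≥0∞} {R B : Finset V} {v : V}
    (hf : Measurable f) (hg : Measurable g) (hq : ∀ᵐ x ∂(Measure.pi μ), q x = f x * g x)
    (hvR : v ∈ R) (hvB : v ∉ B) (hfd : DependsOn f ((insert v B : Finset V) : Set V))
    (hgd : DependsOn g {v}ᶜ)
    (h0 : ∀ s ⊆ R, ∀ᵐ x ∂(Measure.pi μ), lmarginal μ s q x ≠ 0)
    (ht : ∀ s ⊆ R, ∀ᵐ x ∂(Measure.pi μ), lmarginal μ s q x ≠ ∞) :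
    ∀ᵐ x ∂(Measure.pi μ), q x / condDensity μ R q v B x = lmarginal μ {v} q x := by
  set T := R \ insert v B
  have hRB : R \ B = {v} ∪ T := by
    ext w
    simp only [T, Finset.mem_sdiff, Finset.mem_union, Finset.mem_singleton, Finset.mem_insert]
    by_cases hw : w = v
    · subst hw
      simp [hvR, hvB]
    · simp [hw]
  have dv : Disjoint ({v}ᶜ : Set V) (({v} : Finset V) : Set V) := by
    simp
  have dT : Disjoint ((insert v B : Finset V) : Set V) (T : Set V) := by
    rw [Finset.disjoint_coe]
    exact Finset.disjoint_sdiff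
  have mT : lmarginal μ T (fun x => f x * g x) = fun x => f x * lmarginal μ T g x :=
    lmarginal_mul_left hfd dT hg
  have mv : lmarginal μ {v} (fun x => f x * g x) = fun x => lmarginal μ {v} f x * g x :=
    lmarginal_mul_right hgd dv hf
  have mvT : lmarginal μ ({v} ∪ T) (fun x => f x * g x) =
      fun x => lmarginal μ {v} f x * lmarginal μ T g x := by
    rw [lmarginal_union μ (fun x => f x * g x) (hf.mul hg) (by simp [T]), mT]
    exact lmarginal_mul_right (hgd.lmarginal T) dv hf
  filter_upwards [hq, lmarginal_congr_ae hq T, lmarginal_congr_ae hq {v},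
    lmarginal_congr_ae hq ({v} ∪ T), h0 T Finset.sdiff_subset, ht T Finset.sdiff_subset,
    h0 (R \ B) Finset.sdiff_subset, ht (R \ B) Finset.sdiff_subset]
    with x hx hxT hxv hxvT a1 a2 a3 a4
  rw [hRB, hxvT, mvT] at a3 a4
  rw [hxT, mT] at a1 a2
  rw [condDensity, hRB, hxT, hxvT, hxv, hx, mT, mv, mvT]
  exact ENNReal.div_div_mul_eq a1 a2 a3 a4

/-! ### Fixing childless vertices integrates them out -/

/-- The recursion peels vertices off the front, whereas marginalization extends a sequence at its
end. -/
theorem fixKernelSeq_append_singleton (G : CADMG V) (q : (∀ v, Ω v) → ℝ≥0∞) (l : List V) (v : V) :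
    fixKernelSeq μ G q (l ++ [v]) =
      fixKernel μ (G.fix l.toFinset) (fixKernelSeq μ G q l) v := by
  induction l generalizing G q with
  | nil => simp [fixKernelSeq, CADMG.fix_empty]
  | cons u l ih =>
    simp only [List.cons_append, fixKernelSeq, ih, CADMG.fix_fix, List.toFinset_cons,
      Finset.insert_eq]

/-- Let the fixing sequence `l` integrate its vertices out. If `v` has no children
afterwards, then fixing `v` integrates `v` out, too. -/
theorem fixKernelSeq_childless {p : (∀ v, Ω v) → ℝ≥0∞} (hp : IsPositiveDensity μ p) {G : ADMG V}
    (hG : NestedMarkov μ p G) {l : List V} (hl : G.ValidSeq l) {v : V} (hv : v ∉ l)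
    (hchild : ∀ w, ¬ (G.fix l.toFinset).dir v w)
    (hmarg : ∀ᵐ x ∂(Measure.pi μ),
      fixKernelSeq μ G.toCADMG p l x = lmarginal μ l.toFinset p x) :
    ∀ᵐ x ∂(Measure.pi μ),
      fixKernelSeq μ G.toCADMG p (l ++ [v]) x = lmarginal μ (insert v l.toFinset) p x := by
  obtain ⟨q, hq, hfac⟩ := hG
  set H := G.fix l.toFinset with hH
  have hvH : v ∈ H.random := by
    simp [hH, CADMG.random_fix, CADMG.mem_random, G.fixed_eq, hv]
  have hker : ∀ D ∈ H.districts, IsKernel μ D (G.parents D) (q D) := fun D hD =>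
    hq D (hl.intrinsic hD)
  -- Edges into a vertex that is still random survive the fixing.
  have hpar : ∀ D ∈ H.districts, ∀ w, ∀ d ∈ D, G.dir w d → H.dir w d := fun D hD w d hd h => by
    have := CADMG.subset_random_of_mem_districts hD hd
    rw [hH, CADMG.random_fix, Finset.mem_sdiff] at this
    exact ⟨h, this.2⟩
  have hDv : H.district v ∈ H.districts := CADMG.mem_districts.2 ⟨v, hvH, rfl⟩
  have hfd : DependsOn (q (H.district v)) ((insert v (H.markovBlanket v) : Finset V) : Set V) := by
    refine (hker _ hDv).dependsOn.mono ?_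
    rw [Finset.coe_subset, CADMG.markovBlanket]
    intro w hw
    rw [Finset.mem_insert, Finset.mem_erase]
    by_cases hwv : w = v
    · exact .inl hwv
    · refine .inr ⟨hwv, ?_⟩
      rw [Finset.mem_union, CADMG.mem_parents] at hw ⊢
      exact hw.imp_right fun ⟨d, hd, h⟩ => ⟨d, hd, hpar _ hDv w d hd h⟩
  -- The other factors do not involve `v`: it lies in none of their districts and has no children
  -- there.
  have hgd : DependsOn (fun x => ∏ D ∈ H.districts.erase (H.district v), q D x) {v}ᶜ := by
    refine DependsOn.finset_prod fun D hD => ?_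
    rw [Finset.mem_erase] at hD
    refine (hker D hD.2).dependsOn.mono fun w hw hwv => ?_
    obtain rfl : w = v := hwv
    rw [Finset.mem_coe, Finset.mem_union, CADMG.mem_parents] at hw
    rcases hw with hw | ⟨d, hd, h⟩
    · obtain ⟨u, hu, rfl⟩ := CADMG.mem_districts.1 hD.2
      exact hD.1 (CADMG.district_eq_of_mem hw).symm
    · exact hchild d (hpar D hD.2 _ d hd h)
  -- Marginals of the current kernel are marginals of `p`, hence nonzero and finite almost
  -- everywhere.
  have hlm : ∀ s ⊆ H.random, ∀ᵐ x ∂(Measure.pi μ),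
      lmarginal μ s (fixKernelSeq μ G.toCADMG p l) x = lmarginal μ (s ∪ l.toFinset) p x := by
    intro s hs
    have hd : Disjoint s l.toFinset := by
      rw [hH, CADMG.random_fix] at hs
      exact Finset.disjoint_of_subset_left hs Finset.sdiff_disjoint
    rw [lmarginal_union μ p hp.measurable hd]
    exact lmarginal_congr_ae hmarg s
  have hmain := div_condDensity_eq_lmarginal (μ := μ)
    (q := fixKernelSeq μ G.toCADMG p l) (hker _ hDv).measurable
    (Finset.measurable_prod _ fun D hD => (hker D (Finset.mem_of_mem_erase hD)).measurable)
    (by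
      filter_upwards [hfac l hl] with x hx
      rw [hx, Finset.mul_prod_erase _ (fun D => q D x) hDv])
    hvH (by simp [CADMG.markovBlanket]) hfd hgd
    (fun s hs => by
      filter_upwards [hlm s hs, hp.lmarginal_ne_zero (s ∪ l.toFinset)] with x h1 h2
      rwa [h1])
    (fun s hs => by
      filter_upwards [hlm s hs, hp.lmarginal_ne_top (s ∪ l.toFinset)] with x h1 h2
      rwa [h1])
  filter_upwards [hmain, hlm {v} (by simpa using hvH)] with x h1 h2
  rw [fixKernelSeq_append_singleton, Finset.insert_eq, ← h2, ← h1]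
  rfl

end Marginals

/-! ### Graphs on anchor, treatment, mediator and outcome -/

/-- The position of a variable in the causal order `Z, A, M, Y`. -/
def Var.rank : Var → ℕ
  | .Z => 0
  | .A => 1
  | .M => 2
  | .Y => 3

/-- An edge against this order would close a cycle with A → M → Y or complete a directed path from A
to Z. -/
theorem topologicalOrder_rank {G : ADMG Var} (h : Mediation G)
    (hAZ : ¬ Relation.TransGen G.dir .A .Z) : TopologicalOrder G Var.rank := by
  have hAY : Relation.TransGen G.dir .A .Y := .tail (.single h.1) h.2
  refine ⟨fun a b hab => by cases a <;> cases b <;> simp_all [Var.rank], fun a b hab => ?_⟩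
  cases a <;> cases b <;> simp only [Var.rank, Nat.ofNat_pos, Nat.one_lt_ofNat, zero_lt_one,
    Nat.reduceLT]
  · exact (G.acyclic _ (.single hab)).elim
  · exact (hAZ (.single hab)).elim
  · exact (G.acyclic _ (.single hab)).elim
  · exact (hAZ (.tail (.single h.1) hab)).elim
  · exact (G.acyclic _ (.tail (.single h.1) hab)).elim
  · exact (G.acyclic _ (.single hab)).elim
  · exact (hAZ (hAY.tail hab)).elim
  · exact (G.acyclic _ (hAY.tail hab)).elim
  · exact (G.acyclic _ (.tail (.single h.2) hab)).elim
  · exact (G.acyclic _ (.single hab)).elim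

theorem not_dir_of_topologicalOrder {V : Type*} [Fintype V] [DecidableEq V] {G : ADMG V}
    {ord : V → ℕ} (h : TopologicalOrder G ord) {a b : V} (hab : ord b ≤ ord a) : ¬ G.dir a b :=
  fun hd => (h.2 a b hd).not_ge hab

theorem CADMG.district_eq_singleton {V : Type*} [Fintype V] [DecidableEq V] {G : CADMG V} {v : V}
    (hv : v ∈ G.random) (h : ∀ w, ¬ G.bi v w) : G.district v = {v} := by
  ext w
  rw [mem_district, Finset.mem_singleton]
  constructor
  · rintro ⟨-, hw⟩
    rcases hw.cases_head with e | ⟨u, hu, -⟩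
    · exact e.symm
    · exact (h u hu).elim
  · rintro rfl
    exact ⟨hv, .refl⟩

theorem CADMG.fixable_of_childless {V : Type*} [Fintype V] [DecidableEq V] {G : CADMG V} {v : V}
    (hv : v ∈ G.random) (h : ∀ w, ¬ G.dir v w) : G.Fixable v := by
  refine ⟨hv, fun w _ _ hw => ?_⟩
  obtain ⟨u, hu, -⟩ := Relation.TransGen.head'_iff.1 hw.1
  exact h u hu

theorem IsKernel.dependsOn_singleton {V : Type*} [Fintype V] [DecidableEq V] {Ω : V → Type*}
    [∀ v, MeasurableSpace (Ω v)] {μ : ∀ v, Measure (Ω v)} {G : CADMG V} {v : V}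
    {q : (∀ v, Ω v) → ℝ≥0∞} (hq : IsKernel μ {v} (G.parents {v}) q) (h : ∀ w, ¬ G.dir w v) :
    DependsOn q {v} := by
  have hpa : G.parents {v} = ∅ := by
    ext w
    simp [CADMG.mem_parents, h]
  simpa [hpa] using hq.dependsOn

section FourVariables

variable {Ω : Var → Type*} [∀ v, MeasurableSpace (Ω v)]
  {μ : ∀ v, Measure (Ω v)} [∀ v, SigmaFinite (μ v)]
  {p : (∀ v, Ω v) → ℝ≥0∞} {G : ADMG Var}

/-- If `Z` and `A` are not adjacent, then they are independent. -/
theorem ordIndep_Z_A (hp : IsPositiveDensity μ p) (hG : NestedMarkov μ p G)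
    (hord : TopologicalOrder G Var.rank) (hd : ¬ G.dir .Z .A) (hb : ¬ G.bi .Z .A) :
    OrdIndep μ p .Z .A ∅ := by
  have hrand : ∀ v, v ∈ G.random := fun v => by simp [CADMG.mem_random, G.fixed_eq]
  have hY : ∀ w, ¬ G.dir .Y w := fun w =>
    not_dir_of_topologicalOrder hord (by cases w <;> simp [Var.rank])
  have hM : ∀ w, ¬ (G.fix {.Y}).dir .M w := by
    rintro w ⟨h, hw⟩
    cases w
    · exact not_dir_of_topologicalOrder hord (by simp [Var.rank]) h
    · exact not_dir_of_topologicalOrder hord (by simp [Var.rank]) h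
    · exact not_dir_of_topologicalOrder hord (by simp [Var.rank]) h
    · simp at hw
  have v1 : G.ValidSeq [.Y] := ⟨CADMG.fixable_of_childless (hrand _) hY, trivial⟩
  have v2 : G.ValidSeq [.Y, .M] :=
    ⟨v1.1, CADMG.fixable_of_childless (by simp [CADMG.random_fix, hrand]) hM, trivial⟩
  have m1 := fixKernelSeq_childless hp hG (l := []) trivial (v := .Y) (by simp)
    (fun w h => hY w h.1) (.of_forall fun x => by simp [fixKernelSeq])
  have m2 := fixKernelSeq_childless hp hG (l := [.Y]) v1 (v := .M) (by simp)
    (by simpa using hM) (by simpa using m1)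
  obtain ⟨q, hq, hfac⟩ := hG
  set H := G.fix ([Var.Y, Var.M].toFinset) with hH
  have hZr : Var.Z ∈ H.random := by simp [hH, CADMG.random_fix, hrand]
  have hAr : Var.A ∈ H.random := by simp [hH, CADMG.random_fix, hrand]
  have hZ : H.district .Z = {.Z} := CADMG.district_eq_singleton hZr fun w h => by
    obtain ⟨h, -, hw⟩ := h
    cases w
    · exact G.bi_irrefl _ h
    · exact hb h
    · simp at hw
    · simp at hw
  have hA : H.district .A = {.A} := CADMG.district_eq_singleton hAr fun w h => by
    obtain ⟨h, -, hw⟩ := h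
    cases w
    · exact hb (G.bi_symm _ _ h)
    · exact G.bi_irrefl _ h
    · simp at hw
    · simp at hw
  have hr : H.random = {.Z, .A} := by
    ext w
    cases w <;> simp [hH, CADMG.random_fix, hrand]
  have hdist : H.districts = {{.Z}, {.A}} := by
    rw [CADMG.districts, hr, Finset.image_insert, Finset.image_singleton, hZ, hA]
  have kZ := hq {.Z} (v2.intrinsic (by rw [← hH, hdist]; simp))
  have kA := hq {.A} (v2.intrinsic (by rw [← hH, hdist]; simp))
  have dZ : DependsOn (q {.Z}) {.Z} := kZ.dependsOn_singleton fun w =>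
    not_dir_of_topologicalOrder hord (by simp [Var.rank])
  have dA : DependsOn (q {.A}) {.A} := kA.dependsOn_singleton fun w => by
    cases w
    · exact hd
    all_goals exact not_dir_of_topologicalOrder hord (by simp [Var.rank])
  -- The kernel left after fixing Y and M is the marginal p(Z,A), and its two districts are
  -- singletons without parents.
  have hZA : ∀ᵐ x ∂(Measure.pi μ), lmarginal μ {.M, .Y} p x = q {.Z} x * q {.A} x := by
    filter_upwards [m2, hfac _ v2] with x h1 h2
    rw [← hH, hdist, Finset.prod_pair (by simp)] at h2
    rw [← h2, ← List.singleton_append, h1]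
    rfl
  have margA : lmarginal μ {.A} (fun x => q {.Z} x * q {.A} x) = q {.Z} := by
    rw [lmarginal_mul_left dZ (by simp) kA.measurable]
    ext x
    rw [kA.normalized, mul_one]
  have margZ : lmarginal μ {.Z} (fun x => q {.Z} x * q {.A} x) = q {.A} := by
    rw [lmarginal_mul_right dA (by simp) kZ.measurable]
    ext x
    rw [kZ.normalized, one_mul]
  have e0 : (Finset.univ \ insert Var.Z (insert Var.A ∅) : Finset Var) = {.M, .Y} := by decide
  have eZ : (Finset.univ \ insert Var.Z ∅ : Finset Var) = {.A} ∪ {.M, .Y} := by decide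
  have eA : (Finset.univ \ insert Var.A ∅ : Finset Var) = {.Z} ∪ {.M, .Y} := by decide
  unfold OrdIndep KernelIndep
  rw [e0, eZ, eA, Finset.sdiff_empty, lmarginal_univ,
    lmarginal_union μ p hp.measurable (s := {.A}) (by decide),
    lmarginal_union μ p hp.measurable (s := {.Z}) (by decide)]
  filter_upwards [hZA, lmarginal_congr_ae hZA {.A}, lmarginal_congr_ae hZA {.Z}]
    with x h1 h2 h3
  rw [h1, h2, h3, margA, margZ, hp.lintegral_eq_one, mul_one]

/-- If `Z` is adjacent to `A` at most and no bidirected edge joins `A` to `M` or `Y`, then `Z` and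
`Y` are independent given `A, M`. -/
theorem ordIndep_Z_Y (hG : NestedMarkov μ p G) (hord : TopologicalOrder G Var.rank)
    (hZMd : ¬ G.dir .Z .M) (hZYd : ¬ G.dir .Z .Y) (hZM : ¬ G.bi .Z .M) (hZY : ¬ G.bi .Z .Y)
    (hAM : ¬ G.bi .A .M) (hAY : ¬ G.bi .A .Y) : OrdIndep μ p .Z .Y {.A, .M} := by
  obtain ⟨q, hq, hfac⟩ := hG
  have hker : ∀ D ∈ G.districts, IsKernel μ D (G.parents D) (q D) := fun D hD =>
    hq D (CADMG.ValidSeq.intrinsic (l := []) trivial (by simpa [CADMG.fix_empty] using hD))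
  -- No bidirected edge leaves {M, Y}, so every district lies in {Z, A} or in {M, Y}.
  have hside : ∀ a b, G.bi a b → a ∈ ({.M, .Y} : Set Var) → b ∈ ({.M, .Y} : Set Var) := by
    intro a b h ha
    have h' := G.bi_symm _ _ h
    cases a <;> cases b <;> simp_all
  have hcomp : ∀ D ∈ G.districts, ¬ D ⊆ {.Z, .A} → ∀ w ∈ D, w ∈ ({.M, .Y} : Set Var) := by
    intro D hD hsub w hw
    obtain ⟨u, -, rfl⟩ := CADMG.mem_districts.1 hD
    obtain ⟨c, hc, hcn⟩ := Finset.not_subset.1 hsub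
    rw [← CADMG.district_eq_of_mem hc] at hw
    have hcw := (CADMG.mem_district.1 hw).2
    clear hw
    induction hcw with
    | refl => cases c <;> simp_all
    | tail _ h ih => exact hside _ _ h ih
  have hm : ∀ S ⊆ G.districts, Measurable fun x => ∏ D ∈ S, q D x := fun S hS =>
    Finset.measurable_prod _ fun D hD => (hker D (hS hD)).measurable
  -- The factors are grouped by this dichotomy: Y has no children, so it is absent from the {Z, A}
  -- part; Z has no children in {M, Y}, so it is absent from the other.
  refine ordIndep_of_factorization
    (hm (G.districts.filter (· ⊆ {Var.Z, Var.A})) (Finset.filter_subset _ _))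
    (hm (G.districts.filter (¬ · ⊆ {Var.Z, Var.A})) (Finset.filter_subset _ _))
    ?_ ?_ ?_ ?_ ?_ ?_ ?_
  · filter_upwards [hfac [] trivial] with x hx
    rw [Finset.prod_filter_mul_prod_filter_not]
    simpa [fixKernelSeq, CADMG.fix_empty] using hx
  · decide
  · decide
  · decide
  · decide
  · refine DependsOn.finset_prod fun D hD => ?_
    rw [Finset.mem_filter] at hD
    refine (hker D hD.1).dependsOn.mono fun w hw hwY => ?_
    obtain rfl : w = .Y := hwY
    rw [Finset.mem_coe, Finset.mem_union, CADMG.mem_parents] at hw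
    rcases hw with hw | ⟨d, -, h⟩
    · simpa using hD.2 hw
    · exact not_dir_of_topologicalOrder hord (by cases d <;> simp [Var.rank]) h
  · refine DependsOn.finset_prod fun D hD => ?_
    rw [Finset.mem_filter] at hD
    refine (hker D hD.1).dependsOn.mono fun w hw hwZ => ?_
    obtain rfl : w = .Z := hwZ
    rw [Finset.mem_coe, Finset.mem_union, CADMG.mem_parents] at hw
    rcases hw with hw | ⟨d, hd, h⟩
    · simpa using hcomp D hD.1 hD.2 _ hw
    · rcases hcomp D hD.1 hD.2 d hd with rfl | rfl
      exacts [hZMd h, hZYd h]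

end FourVariables

/-! ### Front-door and instrumental conditions -/

theorem corollary1 {Ω : Var → Type*} [∀ v, MeasurableSpace (Ω v)]
    (μ : ∀ v, Measure (Ω v)) [∀ v, SigmaFinite (μ v)]
    (p : (∀ v, Ω v) → ℝ≥0∞) (hp : IsPositiveDensity μ p)
    (G : ADMG Var) (hG : NestedMarkov μ p G)
    (hA1 : Mediation G) (hA2 : Anchor μ p G) (hA3 : VermaFaithful μ p G)
    (hVerma : VermaConstraint μ p) (hZM : OrdIndep μ p .Z .M {.A}) :
    NestedMarkov μ p G ∧ FrontDoor1 G ∧ FrontDoor2 G ∧ Instrument1 G ∧ Instrument2 G := by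
  obtain ⟨hAZ, hdepZA, hdepZY⟩ := hA2
  have hord := topologicalOrder_rank hA1 hAZ
  have hnf : ∀ v, v ∉ G.fixed := fun v => by simp [G.fixed_eq]
  have hI1 : Instrument1 G := by
    by_contra h
    rw [Instrument1, not_or] at h
    exact hdepZA (ordIndep_Z_A hp hG hord h.1 h.2)
  -- the edge between `Z` and `A`, which survives an intervention on `M`
  obtain ⟨e, heZA, heM, heA⟩ : ∃ e : EdgeMark, G.Edge e .Z .A ∧
      (G.fix {.M}).Edge e .Z .A ∧ e.HeadAtEnd := by
    rcases hI1 with h | h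
    · exact ⟨.fwd, h, ⟨h, by simp⟩, trivial⟩
    · exact ⟨.both, h, ⟨h, by simp, by simp⟩, trivial⟩
  have sepZM := hA3.ordinary _ _ _ (by simp) (by simp) (by simp) hZM
  have hZMd : ¬ G.dir .Z .M := fun h => sepZM (CADMG.mConnected_of_edge (e := .fwd) (by simp) h)
  have hZMb : ¬ G.bi .Z .M := fun h => sepZM (CADMG.mConnected_of_edge (e := .both) (by simp) h)
  have hAM : ¬ G.bi .A .M := fun h => sepZM <|
    CADMG.mConnected_of_two_edges (e' := .both) (b := Var.A) (by simp) (by simp) (by simp) heZA h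
      (CADMG.openAt_collider heA trivial (Finset.mem_singleton_self _) .refl)
  -- conditioning on `A` or `M` opens the collider at `A`
  have hno : ∀ C : Finset Var, .Z ∉ C → .Y ∉ C → ¬ OrdIndep μ p .Z .Y C := by
    intro C hZC hYC hind
    have sep := hA3.ordinary _ _ _ (by simp) hZC hYC hind
    have hZYd : ¬ G.dir .Z .Y := fun h =>
      sep (CADMG.mConnected_of_edge (e := .fwd) (by simp) h)
    have hZYb : ¬ G.bi .Z .Y := fun h =>
      sep (CADMG.mConnected_of_edge (e := .both) (by simp) h)
    by_cases hC : .A ∈ C ∨ .M ∈ C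
    · have hAY : ¬ G.bi .A .Y := fun h => by
        refine sep (CADMG.mConnected_of_two_edges (e' := .both) (b := Var.A) (by simp) (by simp)
          (by simp) heZA h ?_)
        rcases hC with hC | hC
        · exact CADMG.openAt_collider heA trivial hC .refl
        · exact CADMG.openAt_collider heA trivial hC (.single hA1.1)
      exact hdepZY (ordIndep_Z_Y hG hord hZMd hZYd hZMb hZYb hAM hAY)
    · rw [not_or] at hC
      -- With A and M unconditioned, the collider-free path through A → M → Y is open.
      exact sep (CADMG.mConnected_of_three_edges (e' := .fwd) (e'' := .fwd) (b := Var.A) (c := Var.M)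
        (by simp) (by simp) (by simp) (by simp) (by simp) (by simp) heZA hA1.1 hA1.2
        (CADMG.openAt_fwd hC.1 (hnf _)) (CADMG.openAt_fwd hC.2 (hnf _)))
  have hker : KernelIndep μ (Finset.univ \ {.M}) (gFormula μ Var.rank {.M} p) .Z .Y ∅ := by
    have e1 : (Finset.univ \ {.M} : Finset Var) = {.Z, .A, .Y} := by decide
    have e2 : (Finset.univ.filter fun w => Var.rank w < Var.rank .M) = {Var.A, Var.Z} := by decide
    have e3 : gFormula μ Var.rank {.M} p =
        fun x => p x / condDensity μ Finset.univ p .M {.A, .Z} x := by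
      ext x
      rw [gFormula, Finset.prod_singleton, e2]
    rw [e1, e3]
    exact hVerma
  obtain ⟨hident, sep⟩ := hA3.generalized _ hord _ _ _ _ (by simp) (by simp) (by simp)
    (by simp) (by simp) (by simp) hno hker
  have hZYd : ¬ G.dir .Z .Y := fun h =>
    sep (CADMG.mConnected_of_edge (e := .fwd) (by simp) ⟨h, by simp⟩)
  have hZYb : ¬ G.bi .Z .Y := fun h =>
    sep (CADMG.mConnected_of_edge (e := .both) (by simp) ⟨h, by simp, by simp⟩)
  refine ⟨hG, fun h => ?_, ⟨hAM, ?_⟩, hI1, ?_⟩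
  -- The edge A → Y would give a path from Z through A to Y that avoids the fixed vertex M.
  · exact sep (CADMG.mConnected_of_two_edges (e' := .fwd) (b := Var.A) (by simp) (by simp) (by simp)
      heM ⟨h, by simp⟩ (CADMG.openAt_fwd (by simp) (by simp [CADMG.fix, hnf])))
  -- The district of Y after fixing M is intrinsic by identification and does not contain M.
  · have hYr : Var.Y ∈ (G.fix {.M}).random := by simp [CADMG.mem_random, CADMG.fix, hnf]
    refine (hident _ (CADMG.mem_districts.2 ⟨.Y, hYr, rfl⟩)).not_bi_of_dir hA1.2
      (CADMG.mem_district_self hYr) fun h => ?_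
    have := CADMG.district_subset_random _ _ h
    simp [CADMG.mem_random, CADMG.fix] at this
  -- Z is isolated once A is deleted: it has no parents, and no edge joins it to M or Y.
  · refine CADMG.mSeparated_of_isolated (by simp) fun e w h => ?_
    cases e
    · obtain ⟨h, -, hw⟩ := h
      cases w
      · exact G.acyclic _ (.single h)
      · exact hw rfl
      · exact hZMd h
      · exact hZYd h
    · exact not_dir_of_topologicalOrder hord (by simp [Var.rank]) h.1
    · obtain ⟨h, -, hw⟩ := h
      cases w
      · exact G.bi_irrefl _ h
      · exact hw rfl
      · exact hZMb h
      · exact hZYb h
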